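/- Let $q$ be a complex number with $0<|q|<1$. For $x\in\mathbb C$ put $(x;q)_\infty=\prod_{j\ge 0}(1-xq^j)$, $(x;q)_n=\prod_{j=0}^{n-1}(1-xq^j)$ and $(x;q)_{-n}=\prod_{j=1}^{n}(1-xq^{-j})^{-1}$ for integers $n\ge 0$ (so $(x;q)_k=(x;q)_\infty/(xq^k;q)_\infty$), and write $(x_1,\dots,x_r;q)_k=(x_1;q)_k\cdots(x_r;q)_k$ for $k\in\mathbb Z\cup\{\infty\}$. Let $${}_{r}\psi_{r}\!\left[\begin{matrix}x_1,\dots,x_r\\ y_1,\dots,y_r\end{matrix};q,z\right]=\sum_{k=-\infty}^{\infty}\frac{(x_1,\dots,x_r;q)_k}{(y_1,\dots,y_r;q)_k}\,z^k ;$$ its terms are called well-defined if no factor in a denominator vanishes, that is, if $x_i\ne q^{j}$ for all $j\ge 1$ and $y_i\ne q^{-j}$ for all $j\ge 0$ and all $i$ (if $(y_i;q)_k$ with $k<0$ has a vanishing denominator, then $1/(y_i;q)_k=0$). Let $s\ge 0$, let $a,b,c,d,e,h_1,\dots,h_s$ be complex numbers with $a,b,e\neq 0$, let $N$ be an integer,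 let $m_1,\dots,m_s$ be nonnegative integers, and let $|m|=m_1+\dots+m_s$. Write $\{x_\nu\}$ for the list $x_1,\dots,x_s$. Suppose that the terms of both series below are well-defined and that $$\left|\frac{e}{ab}\right|<|q^N|\qquad\text{and}\qquad |cd\,q^N|<|e\,q^{|m|}|$$ (that is, $|e/ab|<|q^N|<|eq^{|m|}/cd|$, the second inequality being void if $cd=0$). Then both series below converge absolutely and $${}_{2+s}\psi_{2+s}\!\left[\begin{matrix}a,b,\{h_\nu q^{m_\nu}\}\\ c,d,\{h_\nu\}\end{matrix};q,\frac{eq^{-N}}{ab}\right] =\left(\frac eq\right)^N\frac{(e/a,e/b,cq/e,dq/e;q)_\infty}{(q/a,q/b,c,d;q)_\infty}\prod_{i=1}^s\frac{(h_iq/e;q)_{m_i}}{(h_i;q)_{m_i}}\; {}_{2+s}\psi_{2+s}\!\left[\begin{matrix}aq/e,bq/e,\{h_\nu q^{1+m_\nu}/e\}\\ cq/e,dq/e,\{h_\nu q/e\}\end{matrix};q,\frac{eq^{-N}}{ab}\right].$$ -/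

import Mathlib

namespace BasicHyp

noncomputable section

/-- The infinite `q`-shifted factorial `(a;q)_∞ = ∏_{j ≥ 0} (1 - a q^j)`
(the product converges for `|q| < 1`). -/
def qInf (a q : ℂ) : ℂ := ∏' j : ℕ, (1 - a * q ^ j)

/-- The `q`-shifted factorial `(a;q)_k` for an integer `k`:
`(a;q)_n = (1 - a)(1 - a q) ⋯ (1 - a q^(n-1))` and
`(a;q)_{-n} = 1 / ((1 - a q^(-1)) ⋯ (1 - a q^(-n)))` for `n ≥ 0`.
This is `(a;q)_∞ / (a q^k;q)_∞` with the common factors cancelled, see `qFac_eq_div`. -/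
def qFac (a q : ℂ) : ℤ → ℂ
  | Int.ofNat n => ∏ j ∈ Finset.range n, (1 - a * q ^ j)
  | Int.negSucc n => (∏ j ∈ Finset.range (n + 1), (1 - a * q ^ (-((j : ℤ) + 1))))⁻¹

/-- The `k`-th term of the bilateral series `_rψ_s`. If `k < 0` and some lower parameter is
`q^n` with `1 ≤ n ≤ -k`, then `1 / (q^n;q)_k = (1 - q^(n-1)) ⋯ (1 - q^(n+k)) = 0`; the conventions
`0⁻¹ = 0` and `x / 0 = 0` give this same value `0`. -/
def psiTerm {r s : ℕ} (a : Fin r → ℂ) (b : Fin s → ℂ) (q z : ℂ) (k : ℤ) : ℂ :=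
  (∏ i, qFac (a i) q k) / (∏ j, qFac (b j) q k)
    * ((-1) ^ k * q ^ (k * (k - 1) / 2)) ^ ((s : ℤ) - (r : ℤ)) * z ^ k

/-- The bilateral basic hypergeometric series `_rψ_s[a_1,…,a_r; b_1,…,b_s; q, z]`. -/
def psi {r s : ℕ} (a : Fin r → ℂ) (b : Fin s → ℂ) (q z : ℂ) : ℂ :=
  ∑' k : ℤ, psiTerm a b q z k

/-- The terms of the bilateral series with upper parameters `a` and lower parameters `b` are
well-defined: no denominator factor is ever zero. For `k < 0` the denominator factors of the
`k`-th term are the `1 - a_i q^(-j)` with `1 ≤ j ≤ -k`; for `k ≥ 0` they are the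
`1 - b_i q^j` with `0 ≤ j < k`. -/
def PsiWellDefined {r s : ℕ} (a : Fin r → ℂ) (b : Fin s → ℂ) (q : ℂ) : Prop :=
  (∀ i, ∀ j : ℕ, 1 - a i * q ^ (-((j : ℤ) + 1)) ≠ 0) ∧ (∀ i, ∀ j : ℕ, 1 - b i * q ^ j ≠ 0)

theorem multipliable_qInf (a : ℂ) {q : ℂ} (hq : ‖q‖ < 1) :
    Multipliable fun j : ℕ => 1 - a * q ^ j := by
  have h : Summable fun j : ℕ => ‖-(a * q ^ j)‖ := by
    simp only [norm_neg, norm_mul, norm_pow]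
    exact (summable_geometric_of_lt_one (norm_nonneg q) hq).mul_left _
  simpa [sub_eq_add_neg] using multipliable_one_add_of_summable h

theorem qInf_eq_prod_mul (a : ℂ) {q : ℂ} (hq : ‖q‖ < 1) (n : ℕ) :
    qInf a q = (∏ j ∈ Finset.range n, (1 - a * q ^ j)) * qInf (a * q ^ n) q := by
  have hf : (fun j : ℕ => 1 - a * q ^ n * q ^ j) = fun j : ℕ => 1 - a * q ^ (j + n) := by
    funext j
    ring
  have h := multipliable_qInf (a * q ^ n) hq
  rw [hf] at h
  have h2 := Multipliable.prod_mul_tprod_nat_mul' (f := fun j : ℕ => 1 - a * q ^ j) (k := n) h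
  unfold qInf
  rw [hf]
  exact h2.symm

/-- `(a;q)_k = (a;q)_∞ / (a q^k;q)_∞` whenever the right side makes sense. -/
theorem qFac_eq_div (a : ℂ) {q : ℂ} (hq0 : q ≠ 0) (hq : ‖q‖ < 1) (k : ℤ)
    (hk : qInf (a * q ^ k) q ≠ 0) : qFac a q k = qInf a q / qInf (a * q ^ k) q := by
  cases k with
  | ofNat n =>
    rw [eq_div_iff hk]
    simpa [qFac] using (qInf_eq_prod_mul a hq n).symm
  | negSucc n =>
    have h := qInf_eq_prod_mul (a * q ^ (Int.negSucc n)) hq (n + 1)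
    have h1 : a * q ^ (Int.negSucc n) * q ^ (n + 1) = a := by
      rw [zpow_negSucc, mul_assoc, inv_mul_cancel₀ (pow_ne_zero _ hq0), mul_one]
    have h2 : ∏ j ∈ Finset.range (n + 1), (1 - a * q ^ (Int.negSucc n) * q ^ j)
        = ∏ j ∈ Finset.range (n + 1), (1 - a * q ^ (-((j : ℤ) + 1))) := by
      rw [← Finset.prod_range_reflect]
      refine Finset.prod_congr rfl fun j hj => ?_
      have hj' : j ≤ n := by simpa [Nat.lt_succ_iff] using hj
      rw [mul_assoc, ← zpow_natCast q (n + 1 - 1 - j), ← zpow_add₀ hq0]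
      congr 3
      rw [Int.negSucc_eq]
      omega
    rw [h1, h2] at h
    rw [h] at hk ⊢
    have h3 := mul_ne_zero_iff.mp hk
    simp only [qFac]
    field_simp [h3.1, h3.2]

end

end BasicHyp

/-! Multiplied by `normalizer`, the left series becomes ∑ e^k q^(k(k-1)) g(q^k) with g(x) = x^(-N)
(cx, dx, q/(ax), q/(bx); q)_∞ P(x): inverting the a- and b-factors produces q^(k(k-1)), and each
pair h_ν q^(m_ν), h_ν contributes a polynomial in q^k, so deg P ≤ |m| (`normalizer_mul_psiTerm`).
The right series, shifted by one index, becomes ∑ e^(1-k) q^(k(k-1)) g(q^k/e).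

The two sums agree for formal reasons. On a monomial g = x^n the exponent k(k-1) + nk is invariant
under k ↦ 1-n-k, while e^k turns into e^(1-k) e^(-n), which replaces x^n by (x/e)^n
(`expandedTerm_reflectIndex`). Since n varies, g is expanded into monomials, by Euler's series for
the four infinite products, and the reflection permutes the resulting multiple sum. This is
legitimate because that sum converges absolutely (`summable_expandedTerm`), which is where the two
inequalities enter. -/

namespace BasicHyp

open Filter Topology

/-! ### Euler's series for the infinite q-shifted factorial, over ℂ and over ℝ (for majorants). -/

section Euler

variable {K : Type*} [NormedField K]

/-- The coefficient `q^(i(i-1)/2) / (q;q)_i` of Euler's series for the infinite `q`-shifted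
factorial. -/
def eulerCoeff (q : K) (i : ℕ) : K := ∏ j ∈ Finset.range i, q ^ j / (1 - q ^ (j + 1))

/-- Euler's series `∑ q^(i(i-1)/2) y^i / (q;q)_i = (-y;q)_∞`. -/
noncomputable def euler (q y : K) : K := ∑' i : ℕ, eulerCoeff q i * y ^ i

theorem one_sub_pow_succ_ne_zero {q : K} (hq : ‖q‖ < 1) (j : ℕ) : 1 - q ^ (j + 1) ≠ 0 := by
  intro h
  have h1 : ‖q‖ ^ (j + 1) < 1 := pow_lt_one₀ (norm_nonneg q) hq (by omega)
  rw [← norm_pow, ← sub_eq_zero.mp h, norm_one] at h1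
  exact lt_irrefl _ h1

theorem eulerCoeff_succ (q : K) (i : ℕ) :
    eulerCoeff q (i + 1) = eulerCoeff q i * (q ^ i / (1 - q ^ (i + 1))) :=
  Finset.prod_range_succ _ _

theorem eulerCoeff_norm_nonneg {q : K} (hq : ‖q‖ < 1) (i : ℕ) : 0 ≤ eulerCoeff ‖q‖ i :=
  Finset.prod_nonneg fun j _ => div_nonneg (pow_nonneg (norm_nonneg q) j)
    (sub_nonneg.mpr (pow_le_one₀ (norm_nonneg q) hq.le))

theorem norm_eulerCoeff_le {q : K} (hq : ‖q‖ < 1) (i : ℕ) :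
    ‖eulerCoeff q i‖ ≤ eulerCoeff ‖q‖ i := by
  rw [eulerCoeff, norm_prod]
  refine Finset.prod_le_prod (fun j _ => norm_nonneg _) fun j _ => ?_
  rw [norm_div, norm_pow]
  have h1 : ‖q‖ ^ (j + 1) < 1 := pow_lt_one₀ (norm_nonneg q) hq (by omega)
  have h2 : 1 - ‖q‖ ^ (j + 1) ≤ ‖1 - q ^ (j + 1)‖ := by
    simpa using norm_sub_norm_le (1 : K) (q ^ (j + 1))
  exact div_le_div_of_nonneg_left (pow_nonneg (norm_nonneg q) j) (by linarith) h2

theorem summable_norm_euler {q : K} (hq : ‖q‖ < 1) (y : K) :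
    Summable fun i : ℕ => ‖eulerCoeff q i * y ^ i‖ := by
  have hlim : Tendsto (fun i : ℕ => ‖q‖ ^ i / (1 - ‖q‖ ^ (i + 1)) * ‖y‖) atTop (𝓝 0) := by
    have h0 := tendsto_pow_atTop_nhds_zero_of_lt_one (norm_nonneg q) hq
    have h1 := (h0.div ((h0.comp (tendsto_add_atTop_nat 1)).const_sub 1)
      (by norm_num)).mul_const ‖y‖
    simpa using! h1
  have hev : ∀ᶠ i : ℕ in atTop, ‖q‖ ^ i / (1 - ‖q‖ ^ (i + 1)) * ‖y‖ ≤ 1 / 2 :=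
    hlim.eventually_le_const (by norm_num)
  refine summable_of_ratio_norm_eventually_le (r := 1 / 2) (by norm_num) ?_ |>.of_nonneg_of_le
    (f := fun i : ℕ => eulerCoeff ‖q‖ i * ‖y‖ ^ i) (fun _ => norm_nonneg _) fun i => ?_
  · filter_upwards [hev] with i hi
    have hc := eulerCoeff_norm_nonneg hq i
    have hc' := eulerCoeff_norm_nonneg hq (i + 1)
    rw [Real.norm_of_nonneg (by positivity), Real.norm_of_nonneg (by positivity),
      eulerCoeff_succ, pow_succ]
    calc eulerCoeff ‖q‖ i * (‖q‖ ^ i / (1 - ‖q‖ ^ (i + 1))) * (‖y‖ ^ i * ‖y‖)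
        = (‖q‖ ^ i / (1 - ‖q‖ ^ (i + 1)) * ‖y‖) * (eulerCoeff ‖q‖ i * ‖y‖ ^ i) := by ring
      _ ≤ 1 / 2 * (eulerCoeff ‖q‖ i * ‖y‖ ^ i) := by gcongr
  · rw [norm_mul, norm_pow]
    exact mul_le_mul_of_nonneg_right (norm_eulerCoeff_le hq i) (by positivity)

variable [CompleteSpace K]

theorem hasSum_euler {q : K} (hq : ‖q‖ < 1) (y : K) :
    HasSum (fun i : ℕ => eulerCoeff q i * y ^ i) (euler q y) :=
  (summable_norm_euler hq y).of_norm.hasSum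

theorem euler_eq_mul {q : K} (hq : ‖q‖ < 1) (y : K) :
    euler q y = (1 + y) * euler q (y * q) := by
  have h1 := hasSum_euler hq y
  have h2 := hasSum_euler hq (y * q)
  have h3 := (hasSum_nat_add_iff' (f := fun i : ℕ =>
    eulerCoeff q i * y ^ i - eulerCoeff q i * (y * q) ^ i) 1).mpr (h1.sub h2)
  have h4 := h2.mul_left y
  -- The difference of the two series has the factor 1 - q^(i+1), which cancels the last denominator
  -- of the coefficient.
  have h5 : (fun i : ℕ => eulerCoeff q (i + 1) * y ^ (i + 1)
      - eulerCoeff q (i + 1) * (y * q) ^ (i + 1))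
      = fun i : ℕ => y * (eulerCoeff q i * (y * q) ^ i) := by
    funext i
    have := one_sub_pow_succ_ne_zero hq i
    rw [eulerCoeff_succ]
    field_simp
    ring
  rw [h5] at h3
  have h6 := h3.unique h4
  simp only [Finset.range_one, Finset.sum_singleton, pow_zero, sub_self, sub_zero] at h6
  linear_combination h6

end Euler

theorem euler_norm_pos {q : ℂ} (hq : ‖q‖ < 1) {y : ℝ} (hy : 0 ≤ y) : 0 < euler ‖q‖ y := by
  have hq' : ‖‖q‖‖ < 1 := by rwa [norm_norm]
  have h := (hasSum_euler hq' y).summable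
  refine h.tsum_pos (fun i => mul_nonneg (eulerCoeff_norm_nonneg hq i) (pow_nonneg hy i)) 0 ?_
  simp [eulerCoeff]

theorem continuous_euler {q : ℂ} (hq : ‖q‖ < 1) : ContinuousAt (euler q) 0 := by
  have hs := summable_norm_euler hq (1 : ℂ)
  have h : ContinuousOn (euler q) (Metric.closedBall 0 1) := by
    refine continuousOn_tsum (u := fun i : ℕ => ‖eulerCoeff q i * 1 ^ i‖)
      (fun i => by fun_prop) hs fun i y hy => ?_
    rw [norm_mul, norm_mul, norm_pow, norm_pow, norm_one]
    have : ‖y‖ ≤ 1 := by simpa using hy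
    gcongr
  exact h.continuousAt (Metric.closedBall_mem_nhds 0 one_pos)

/-- Euler's expansion `(a;q)_∞ = ∑ (-a)^i q^(i(i-1)/2) / (q;q)_i`. -/
theorem qInf_eq_euler {q : ℂ} (hq : ‖q‖ < 1) (a : ℂ) : qInf a q = euler q (-a) := by
  -- The functional equation is iterated n times; as n → ∞ the remaining factor tends to `euler q
  -- 0`, which is 1.
  have hstep : ∀ n : ℕ, euler q (-a)
      = (∏ j ∈ Finset.range n, (1 - a * q ^ j)) * euler q (-a * q ^ n) := by
    intro n
    induction n with
    | zero => simp
    | succ n ih =>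
      rw [ih, euler_eq_mul hq (-a * q ^ n), Finset.prod_range_succ, pow_succ]
      ring_nf
  have h1 := (multipliable_qInf a hq).hasProd.tendsto_prod_nat
  have h2 : Tendsto (fun n : ℕ => euler q (-a * q ^ n)) atTop (𝓝 1) := by
    have h0 : euler q 0 = 1 := by
      unfold euler
      rw [tsum_eq_single 0 (fun i hi => by simp [hi])]
      simp [eulerCoeff]
    have h3 : Tendsto (fun n : ℕ => -a * q ^ n) atTop (𝓝 0) := by
      simpa using (tendsto_pow_atTop_nhds_zero_of_norm_lt_one hq).const_mul (-a)
    have := (continuous_euler hq).tendsto.comp h3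
    rwa [h0] at this
  have h3 := h1.mul h2
  rw [mul_one] at h3
  have h4 : (fun n : ℕ => (∏ j ∈ Finset.range n, (1 - a * q ^ j)) * euler q (-a * q ^ n))
      = fun _ => euler q (-a) := funext fun n => (hstep n).symm
  rw [h4] at h3
  exact tendsto_nhds_unique h3 tendsto_const_nhds

/-! ### Products of four Euler series. -/

section Quad

variable {K : Type*} [NormedField K]

/-- The terms of the product of four Euler series. -/
def quadTerm (q y₁ y₂ y₃ y₄ : K) (p : ℕ × ℕ × ℕ × ℕ) : K :=
  (eulerCoeff q p.1 * y₁ ^ p.1) * ((eulerCoeff q p.2.1 * y₂ ^ p.2.1) *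
    ((eulerCoeff q p.2.2.1 * y₃ ^ p.2.2.1) * (eulerCoeff q p.2.2.2 * y₄ ^ p.2.2.2)))

theorem norm_quadTerm_le {q : K} (hq : ‖q‖ < 1) (y₁ y₂ y₃ y₄ : K) (p : ℕ × ℕ × ℕ × ℕ) :
    ‖quadTerm q y₁ y₂ y₃ y₄ p‖ ≤ quadTerm ‖q‖ ‖y₁‖ ‖y₂‖ ‖y₃‖ ‖y₄‖ p := by
  have h := eulerCoeff_norm_nonneg hq
  simp only [quadTerm, norm_mul, norm_pow]
  have h1 := h p.1
  have h2 := h p.2.1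
  have h3 := h p.2.2.1
  have h4 := h p.2.2.2
  gcongr <;> exact norm_eulerCoeff_le hq _

variable [CompleteSpace K]

theorem hasSum_prod_norm {ι κ : Type*} {f : ι → K} {g : κ → K} {s t : K}
    (nf : Summable fun i => ‖f i‖) (ng : Summable fun i => ‖g i‖)
    (hf : HasSum f s) (hg : HasSum g t) :
    (Summable fun p : ι × κ => ‖f p.1 * g p.2‖) ∧
      HasSum (fun p : ι × κ => f p.1 * g p.2) (s * t) := by
  have h : Summable fun p : ι × κ => ‖f p.1 * g p.2‖ := nf.mul_norm ng
  exact ⟨h, hf.mul hg h.of_norm⟩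

theorem hasSum_prod_four {f₁ f₂ f₃ f₄ : ℕ → K} {s₁ s₂ s₃ s₄ : K}
    (n₁ : Summable fun i => ‖f₁ i‖) (n₂ : Summable fun i => ‖f₂ i‖)
    (n₃ : Summable fun i => ‖f₃ i‖) (n₄ : Summable fun i => ‖f₄ i‖)
    (h₁ : HasSum f₁ s₁) (h₂ : HasSum f₂ s₂) (h₃ : HasSum f₃ s₃) (h₄ : HasSum f₄ s₄) :
    HasSum (fun p : ℕ × ℕ × ℕ × ℕ => f₁ p.1 * (f₂ p.2.1 * (f₃ p.2.2.1 * f₄ p.2.2.2)))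
      (s₁ * (s₂ * (s₃ * s₄))) := by
  obtain ⟨m, h⟩ := hasSum_prod_norm n₃ n₄ h₃ h₄
  obtain ⟨m', h'⟩ := hasSum_prod_norm n₂ m h₂ h
  exact (hasSum_prod_norm n₁ m' h₁ h').2

theorem hasSum_quadTerm {q : K} (hq : ‖q‖ < 1) (y₁ y₂ y₃ y₄ : K) :
    HasSum (quadTerm q y₁ y₂ y₃ y₄)
      (euler q y₁ * (euler q y₂ * (euler q y₃ * euler q y₄))) := by
  have h := hasSum_prod_four (summable_norm_euler hq y₁) (summable_norm_euler hq y₂)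
    (summable_norm_euler hq y₃) (summable_norm_euler hq y₄) (hasSum_euler hq y₁)
    (hasSum_euler hq y₂) (hasSum_euler hq y₃) (hasSum_euler hq y₄)
  exact h

end Quad

/-! ### A positive bilateral majorant and its convergence. -/

/-- The majorant of the bilateral series, with `E = euler r`. -/
noncomputable def majorant (r ε α β γ δ : ℝ) (k : ℤ) : ℝ :=
  ε ^ k * r ^ (k * (k - 1)) * (euler r (γ * r ^ k) * (euler r (δ * r ^ k) *
    (euler r (α * r ^ (1 - k)) * euler r (β * r ^ (1 - k)))))

/-- This symmetry reduces the half k < 0 to the half k ≥ 0, with the two convergence conditions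
interchanged. -/
theorem majorant_one_sub (r ε α β γ δ : ℝ) (hε : 0 < ε) (k : ℤ) :
    majorant r ε α β γ δ (1 - k) = ε * majorant r ε⁻¹ γ δ α β k := by
  unfold majorant
  rw [zpow_sub₀ hε.ne', zpow_one, inv_zpow, show (1 - k) * (1 - k - 1) = k * (k - 1) by ring,
    show 1 - (1 - k) = k by ring]
  ring

theorem majorant_pos {q : ℂ} (hq0 : 0 < ‖q‖) (hq : ‖q‖ < 1) {ε α β γ δ : ℝ} (hε : 0 < ε)
    (hα : 0 ≤ α) (hβ : 0 ≤ β) (hγ : 0 ≤ γ) (hδ : 0 ≤ δ) (k : ℤ) :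
    0 < majorant ‖q‖ ε α β γ δ k := by
  have h1 := euler_norm_pos hq (y := γ * ‖q‖ ^ k) (by positivity)
  have h2 := euler_norm_pos hq (y := δ * ‖q‖ ^ k) (by positivity)
  have h3 := euler_norm_pos hq (y := α * ‖q‖ ^ (1 - k)) (by positivity)
  have h4 := euler_norm_pos hq (y := β * ‖q‖ ^ (1 - k)) (by positivity)
  unfold majorant
  positivity

/-- By the functional equation of `euler`, the ratio of consecutive terms is rational in r^n, with
limit εαβ. -/
theorem summable_majorant_nat {q : ℂ} (hq0 : 0 < ‖q‖) (hq : ‖q‖ < 1) {ε α β γ δ : ℝ}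
    (hε : 0 < ε) (hα : 0 ≤ α) (hβ : 0 ≤ β) (hγ : 0 ≤ γ) (hδ : 0 ≤ δ) (h : ε * (α * β) < 1) :
    Summable fun n : ℕ => majorant ‖q‖ ε α β γ δ n := by
  have hpos := majorant_pos hq0 hq hε hα hβ hγ hδ
  have hq' : ‖‖q‖‖ < 1 := by rwa [norm_norm]
  generalize ‖q‖ = r at *
  have hpow : Tendsto (fun n : ℕ => r ^ n) atTop (𝓝 0) :=
    tendsto_pow_atTop_nhds_zero_of_lt_one hq0.le hq
  refine summable_of_ratio_test_tendsto_lt_one h (.of_forall fun n => (hpos n).ne') ?_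
  have hratio : ∀ n : ℕ, ‖majorant r ε α β γ δ ((n + 1 : ℕ) : ℤ)‖ / ‖majorant r ε α β γ δ n‖
      = ε * ((r ^ n + α) * (r ^ n + β)) / ((1 + γ * r ^ n) * (1 + δ * r ^ n)) := by
    intro n
    rw [Real.norm_of_nonneg (hpos _).le, Real.norm_of_nonneg (hpos _).le,
      div_eq_div_iff (hpos _).ne' (by positivity)]
    have e1 := euler_eq_mul hq' (γ * r ^ (n : ℤ))
    have e2 := euler_eq_mul hq' (δ * r ^ (n : ℤ))
    have e3 := euler_eq_mul hq' (α * r ^ (-(n : ℤ)))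
    have e4 := euler_eq_mul hq' (β * r ^ (-(n : ℤ)))
    have s1 : r ^ ((n : ℤ) + 1) = r ^ (n : ℤ) * r := zpow_add_one₀ hq0.ne' _
    have s2 : r ^ (1 - (n : ℤ)) = r ^ (-(n : ℤ)) * r := by
      rw [← zpow_add_one₀ hq0.ne']; congr 1; ring
    have s3 : r ^ (((n : ℤ) + 1) * ((n : ℤ) + 1 - 1))
        = r ^ ((n : ℤ) * ((n : ℤ) - 1)) * (r ^ n * r ^ n) := by
      rw [← zpow_natCast, ← zpow_add₀ hq0.ne', ← zpow_add₀ hq0.ne']; congr 1; ring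
    have s4 : 1 - ((n : ℤ) + 1) = -(n : ℤ) := by ring
    simp only [majorant, Nat.cast_add, Nat.cast_one, s4]
    rw [s3, s1, s2, zpow_add_one₀ hε.ne', e1, e2, e3, e4]
    have hr : r ^ (-(n : ℤ)) * r ^ n = 1 := by
      rw [zpow_neg, zpow_natCast, inv_mul_cancel₀ (by positivity)]
    have a1 : (1 + α * r ^ (-(n : ℤ))) * r ^ n = r ^ n + α := by linear_combination α * hr
    have a2 : (1 + β * r ^ (-(n : ℤ))) * r ^ n = r ^ n + β := by linear_combination β * hr
    rw [← a1, ← a2]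
    simp only [zpow_natCast]
    ring_nf
  simp only [hratio]
  have := ((((hpow.add_const α).mul (hpow.add_const β)).const_mul ε).div
    (((hpow.const_mul γ).const_add 1).mul ((hpow.const_mul δ).const_add 1)) (by norm_num))
  simpa using! this

theorem summable_majorant {q : ℂ} (hq0 : 0 < ‖q‖) (hq : ‖q‖ < 1) {ε α β γ δ : ℝ}
    (hε : 0 < ε) (hα : 0 ≤ α) (hβ : 0 ≤ β) (hγ : 0 ≤ γ) (hδ : 0 ≤ δ) (h : ε * (α * β) < 1)
    (h' : γ * δ < ε) : Summable (majorant ‖q‖ ε α β γ δ) := by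
  refine Summable.of_nat_of_neg (summable_majorant_nat hq0 hq hε hα hβ hγ hδ h) ?_
  have h1 := summable_majorant_nat hq0 hq (inv_pos.mpr hε) hγ hδ hα hβ
    (by rwa [inv_mul_lt_iff₀ hε, mul_one])
  -- The shift is needed because -n = 1 - (n+1).
  have h2 := ((summable_nat_add_iff 1).mpr h1).mul_left ε
  refine h2.congr fun n => ?_
  rw [← majorant_one_sub _ _ _ _ _ _ hε]
  congr 1
  push_cast
  ring

/-! ### The expanded sum and its reflection symmetry. -/

/-- The terms of `∑ₖ u^k q^(k(k-1)) (-c q^k, -d q^k, -a q^(1-k), -b q^(1-k); q)_∞` after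
expanding the four products by Euler's formula. -/
noncomputable def expandedTerm (q u a b c d : ℂ) (x : ℤ × (ℕ × ℕ × ℕ × ℕ)) : ℂ :=
  u ^ x.1 * q ^ (x.1 * (x.1 - 1)) *
    quadTerm q (c * q ^ x.1) (d * q ^ x.1) (a * q ^ (1 - x.1)) (b * q ^ (1 - x.1)) x.2

/-- The theta-type function `(-c x, -d x, -a q/x, -b q/x; q)_∞` at `x = q^k`. -/
noncomputable def quadEuler (q a b c d : ℂ) (k : ℤ) : ℂ :=
  euler q (c * q ^ k) * (euler q (d * q ^ k) *
    (euler q (a * q ^ (1 - k)) * euler q (b * q ^ (1 - k))))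

/-- Taking norms termwise replaces every parameter by its absolute value. For fixed k the inner sum
is then again a product of four Euler series, namely `majorant`, and that is summable over k. -/
theorem summable_expandedTerm {q u a b c d : ℂ} (hq0 : 0 < ‖q‖) (hq : ‖q‖ < 1) (hu : u ≠ 0)
    (h : ‖u * (a * b)‖ < 1) (h' : ‖c * d‖ < ‖u‖) : Summable (expandedTerm q u a b c d) := by
  have hq' : ‖‖q‖‖ < 1 := by rwa [norm_norm]
  have hM := summable_majorant hq0 hq (norm_pos_iff.mpr hu) (norm_nonneg a) (norm_nonneg b)
    (norm_nonneg c) (norm_nonneg d) (by simpa only [norm_mul] using h)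
    (by simpa only [norm_mul] using h')
  let G : ℤ × (ℕ × ℕ × ℕ × ℕ) → ℝ := fun x => ‖u‖ ^ x.1 * ‖q‖ ^ (x.1 * (x.1 - 1)) *
    quadTerm ‖q‖ (‖c‖ * ‖q‖ ^ x.1) (‖d‖ * ‖q‖ ^ x.1) (‖a‖ * ‖q‖ ^ (1 - x.1))
      (‖b‖ * ‖q‖ ^ (1 - x.1)) x.2
  have hle : ∀ x, ‖expandedTerm q u a b c d x‖ ≤ G x := by
    intro x
    simp only [expandedTerm, G, norm_mul, norm_zpow]
    refine mul_le_mul_of_nonneg_left ?_ (by positivity)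
    have := norm_quadTerm_le hq (c * q ^ x.1) (d * q ^ x.1) (a * q ^ (1 - x.1))
      (b * q ^ (1 - x.1)) x.2
    simpa only [norm_mul, norm_zpow] using this
  have hsum : ∀ k : ℤ, HasSum (fun p => G (k, p)) (majorant ‖q‖ ‖u‖ ‖a‖ ‖b‖ ‖c‖ ‖d‖ k) :=
    fun k => (hasSum_quadTerm hq' _ _ _ _).mul_left _
  refine Summable.of_norm_bounded (g := G) ?_ hle
  refine (summable_prod_of_nonneg fun x => (norm_nonneg _).trans (hle x)).mpr
    ⟨fun k => (hsum k).summable, ?_⟩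
  exact hM.congr fun k => ((hsum k).tsum_eq).symm

theorem hasSum_of_hasSum_expandedTerm {q u a b c d S : ℂ} (hq : ‖q‖ < 1)
    (h : HasSum (expandedTerm q u a b c d) S) :
    HasSum (fun k : ℤ => u ^ k * q ^ (k * (k - 1)) * quadEuler q a b c d k) S := by
  have hk : ∀ k : ℤ, HasSum (fun p => expandedTerm q u a b c d (k, p))
      (u ^ k * q ^ (k * (k - 1)) * quadEuler q a b c d k) := by
    intro k
    have h' := (hasSum_quadTerm hq (c * q ^ k) (d * q ^ k) (a * q ^ (1 - k))
      (b * q ^ (1 - k))).mul_left (u ^ k * q ^ (k * (k - 1)))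
    exact h'
  exact h.prod_fiberwise hk

/-- The involution `k ↦ 1 - n - k`, where `n` is the degree of the term. -/
def reflectIndex (M : ℤ) : ℤ × (ℕ × ℕ × ℕ × ℕ) ≃ ℤ × (ℕ × ℕ × ℕ × ℕ) where
  toFun x := (1 - (x.2.1 + x.2.2.1 - x.2.2.2.1 - x.2.2.2.2 + M) - x.1, x.2)
  invFun x := (1 - (x.2.1 + x.2.2.1 - x.2.2.2.1 - x.2.2.2.2 + M) - x.1, x.2)
  left_inv x := by simp
  right_inv x := by simp

/-- With n = i + j - l - m + M, the q-exponent is k(k-1) + nk plus a term free of k, hence invariant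
under k ↦ 1-n-k. The power e^(1-n-k) splits into e^(1-M), e^(-k) and the factors that rescale a, b
by e and c, d by 1/e. -/
theorem expandedTerm_reflectIndex {q e : ℂ} (hq0 : q ≠ 0) (he : e ≠ 0) (a b c d : ℂ) (M : ℤ)
    (x : ℤ × (ℕ × ℕ × ℕ × ℕ)) :
    expandedTerm q (e * q ^ M) a b c d (reflectIndex M x)
      = e ^ (1 - M) * expandedTerm q (e⁻¹ * q ^ M) (a * e) (b * e) (c / e) (d / e) x := by
  obtain ⟨k, i, j, l, m⟩ := x
  have key : ∀ n : ℤ, n = (i : ℤ) + j - l - m + M →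
      e ^ (1 - n - k) * q ^ (M * (1 - n - k)) * q ^ ((1 - n - k) * (1 - n - k - 1))
        * (q ^ ((1 - n - k) * i) * q ^ ((1 - n - k) * j) * q ^ ((1 - (1 - n - k)) * l)
          * q ^ ((1 - (1 - n - k)) * m))
      = e ^ (1 - M) * (e ^ (-k) * q ^ (M * k) * q ^ (k * (k - 1))
        * (q ^ (k * i) * q ^ (k * j) * q ^ ((1 - k) * l) * q ^ ((1 - k) * m))
        * (e ^ (-(i : ℤ)) * e ^ (-(j : ℤ)) * e ^ (l : ℤ) * e ^ (m : ℤ))) := by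
    intro n hn
    have h1 : ∀ A B C D E F : ℤ, q ^ A * q ^ B * (q ^ C * q ^ D * q ^ E * q ^ F)
        = q ^ (A + B + (C + D + E + F)) := fun A B C D E F => by simp only [zpow_add₀ hq0]
    have h2 : e ^ (1 - n - k) = e ^ (1 - M) * (e ^ (-k) * (e ^ (-(i : ℤ)) * e ^ (-(j : ℤ))
        * e ^ (l : ℤ) * e ^ (m : ℤ))) := by
      simp only [← zpow_add₀ he]; congr 1; rw [hn]; ring
    have h3 := h1 (M * (1 - n - k)) ((1 - n - k) * (1 - n - k - 1)) ((1 - n - k) * i)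
      ((1 - n - k) * j) ((1 - (1 - n - k)) * l) ((1 - (1 - n - k)) * m)
    have h4 := h1 (M * k) (k * (k - 1)) (k * i) (k * j) ((1 - k) * l) ((1 - k) * m)
    have h5 : M * (1 - n - k) + (1 - n - k) * (1 - n - k - 1) + ((1 - n - k) * i
        + (1 - n - k) * j + (1 - (1 - n - k)) * l + (1 - (1 - n - k)) * m)
        = M * k + k * (k - 1) + (k * i + k * j + (1 - k) * l + (1 - k) * m) := by
      rw [hn]; ring
    rw [h5, ← h4] at h3
    rw [h2]
    linear_combination (e ^ (1 - M) * (e ^ (-k) * (e ^ (-(i : ℤ)) * e ^ (-(j : ℤ))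
        * e ^ (l : ℤ) * e ^ (m : ℤ)))) * h3
  have hk := key _ rfl
  simp only [expandedTerm, reflectIndex, Equiv.coe_fn_mk, quadTerm, mul_pow, mul_zpow, div_pow]
  simp only [zpow_mul, zpow_natCast, zpow_neg, inv_zpow] at hk ⊢
  simp only [div_eq_mul_inv]
  linear_combination (eulerCoeff q i * eulerCoeff q j * eulerCoeff q l * eulerCoeff q m
    * c ^ i * d ^ j * a ^ l * b ^ m) * hk

/-- The bilateral sums of `e^k q^(k(k-1)) g(q^k)` and `e^(1-k) q^(k(k-1)) g(q^k/e)` agree for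
`g(x) = x^M (-c x, -d x, -a q/x, -b q/x; q)_∞`. -/
theorem exists_hasSum_quadEuler {q e a b c d : ℂ} (hq0 : 0 < ‖q‖) (hq : ‖q‖ < 1) (he : e ≠ 0)
    (M : ℤ) (h : ‖e * q ^ M * (a * b)‖ < 1) (h' : ‖c * d‖ < ‖e * q ^ M‖) :
    ∃ S : ℂ, HasSum (fun k : ℤ => (e * q ^ M) ^ k * q ^ (k * (k - 1)) * quadEuler q a b c d k) S ∧
      HasSum (fun k : ℤ => e ^ (1 - M) * ((e⁻¹ * q ^ M) ^ k * q ^ (k * (k - 1)) *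
        quadEuler q (a * e) (b * e) (c / e) (d / e) k)) S := by
  have hq0' : q ≠ 0 := norm_pos_iff.mp hq0
  have hs := (summable_expandedTerm hq0 hq (mul_ne_zero he (zpow_ne_zero M hq0')) h h').hasSum
  refine ⟨_, hasSum_of_hasSum_expandedTerm hq hs, ?_⟩
  have hr := (reflectIndex M).hasSum_iff.mpr hs
  have hr' : HasSum (fun x => e ^ (1 - M) *
      expandedTerm q (e⁻¹ * q ^ M) (a * e) (b * e) (c / e) (d / e) x) _ :=
    hr.congr_fun fun x => (expandedTerm_reflectIndex hq0' he a b c d M x).symm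
  have hF := hr'.mul_left (e ^ (1 - M))⁻¹
  simp only [inv_mul_cancel_left₀ (zpow_ne_zero (1 - M) he)] at hF
  have hF' := (hasSum_of_hasSum_expandedTerm hq hF).mul_left (e ^ (1 - M))
  rwa [mul_inv_cancel_left₀ (zpow_ne_zero (1 - M) he)] at hF'

/-! ### Finite q-shifted factorials in terms of infinite ones. -/

theorem qInf_eq_mul (a : ℂ) {q : ℂ} (hq : ‖q‖ < 1) : qInf a q = (1 - a) * qInf (a * q) q := by
  simpa using qInf_eq_prod_mul a hq 1

theorem qInf_ne_zero {a q : ℂ} (hq : ‖q‖ < 1) (h : ∀ j : ℕ, 1 - a * q ^ j ≠ 0) :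
    qInf a q ≠ 0 := by
  have h1 : Summable fun j : ℕ => ‖-(a * q ^ j)‖ := by
    simp only [norm_neg, norm_mul, norm_pow]
    exact (summable_geometric_of_lt_one (norm_nonneg q) hq).mul_left _
  have h2 := tprod_one_add_ne_zero_of_summable (f := fun j : ℕ => -(a * q ^ j))
    (fun j => by simpa [sub_eq_add_neg] using h j) h1
  simpa only [qInf, sub_eq_add_neg] using h2

theorem qInf_div_ne_zero {a q : ℂ} (hq0 : q ≠ 0) (hq : ‖q‖ < 1) (ha : a ≠ 0)
    (h : ∀ j : ℕ, 1 - a * q ^ (-((j : ℤ) + 1)) ≠ 0) : qInf (q / a) q ≠ 0 := by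
  refine qInf_ne_zero hq fun j hj => h j ?_
  have h1 : a = q ^ ((j : ℤ) + 1) := by
    rw [zpow_add_one₀ hq0, zpow_natCast]
    field_simp at hj
    linear_combination hj
  rw [h1, ← zpow_add₀ hq0, add_neg_cancel, zpow_zero, sub_self]

theorem qFac_add_one {a q : ℂ} (h : ∀ j : ℕ, 1 - a * q ^ (-((j : ℤ) + 1)) ≠ 0) (k : ℤ) :
    qFac a q (k + 1) = qFac a q k * (1 - a * q ^ k) := by
  match k with
  | Int.ofNat n =>
    exact (Finset.prod_range_succ _ _).trans (by simp [qFac])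
  | Int.negSucc 0 =>
    have := h 0
    simp only [Nat.cast_zero, zero_add] at this
    simp [qFac, Int.negSucc_eq] at this ⊢
    exact (inv_mul_cancel₀ this).symm
  | Int.negSucc (n + 1) =>
    have h1 : Int.negSucc (n + 1) + 1 = Int.negSucc n := by omega
    have h2 : Int.negSucc (n + 1) = -(((n + 1 : ℕ) : ℤ) + 1) := by omega
    rw [h1]
    simp only [qFac]
    rw [Finset.prod_range_succ _ (n + 1), h2, mul_inv, mul_assoc, inv_mul_cancel₀ (h (n + 1)),
      mul_one]

/-- Both sides satisfy the same first-order recurrence in k and agree at k = 0. Descending divides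
by 1 - a q^k with k < 0, nonzero by hypothesis. -/
theorem qFac_mul_qInf {a q : ℂ} (hq0 : q ≠ 0) (hq : ‖q‖ < 1) (ha : a ≠ 0)
    (h : ∀ j : ℕ, 1 - a * q ^ (-((j : ℤ) + 1)) ≠ 0) (k : ℤ) :
    qFac a q k * qInf (q / a) q
      = (-a) ^ k * q ^ (k * (k - 1) / 2) * qInf (a⁻¹ * q ^ (1 - k)) q := by
  have step : ∀ k : ℤ, (-a) ^ (k + 1) * q ^ ((k + 1) * (k + 1 - 1) / 2)
        * qInf (a⁻¹ * q ^ (1 - (k + 1))) q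
      = (-a) ^ k * q ^ (k * (k - 1) / 2) * qInf (a⁻¹ * q ^ (1 - k)) q * (1 - a * q ^ k) := by
    intro k
    have h1 : (k + 1) * (k + 1 - 1) / 2 = k * (k - 1) / 2 + k := by
      rw [← Int.add_mul_ediv_right _ _ two_ne_zero]
      congr 1
      ring
    have h2 : a⁻¹ * q ^ (1 - (k + 1)) * q = a⁻¹ * q ^ (1 - k) := by
      rw [mul_assoc, ← zpow_add_one₀ hq0]
      congr 2
      ring
    have h3 : q ^ (1 - (k + 1)) * q ^ k = 1 := by
      rw [← zpow_add₀ hq0, show 1 - (k + 1) + k = 0 by ring, zpow_zero]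
    have h4 : a * a⁻¹ = 1 := mul_inv_cancel₀ ha
    rw [h1, qInf_eq_mul _ hq, h2, zpow_add₀ hq0, zpow_add_one₀ (neg_ne_zero.mpr ha)]
    linear_combination ((-a) ^ k * q ^ (k * (k - 1) / 2) * qInf (a⁻¹ * q ^ (1 - k)) q)
      * (q ^ (1 - (k + 1)) * q ^ k * h4 + h3)
  induction k using Int.induction_on with
  | zero => simp [qFac, div_eq_inv_mul]
  | succ n ih => rw [qFac_add_one h, step, ← ih]; ring
  | pred n ih =>
    have hn := h n
    rw [show -((n : ℤ) + 1) = -(n : ℤ) - 1 by ring] at hn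
    have h1 := step (-(n : ℤ) - 1)
    have h2 := qFac_add_one h (-(n : ℤ) - 1)
    rw [sub_add_cancel] at h1 h2
    refine mul_right_cancel₀ hn ?_
    rw [← h1, ← ih, h2]
    ring

theorem inv_qFac_mul_qInf {c q : ℂ} (hq0 : q ≠ 0) (hq : ‖q‖ < 1)
    (h : ∀ j : ℕ, 1 - c * q ^ j ≠ 0) (k : ℤ) :
    (qFac c q k)⁻¹ * qInf c q = qInf (c * q ^ k) q := by
  cases k with
  | ofNat n =>
    rw [qInf_eq_prod_mul c hq n, Int.ofNat_eq_natCast, zpow_natCast]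
    exact inv_mul_cancel_left₀ (Finset.prod_ne_zero_iff.mpr fun j _ => h j) _
  | negSucc n =>
    rw [qInf_eq_prod_mul (c * q ^ Int.negSucc n) hq (n + 1)]
    have h1 : c * q ^ (Int.negSucc n) * q ^ (n + 1) = c := by
      rw [zpow_negSucc, mul_assoc, inv_mul_cancel₀ (pow_ne_zero _ hq0), mul_one]
    rw [h1]
    -- `inv_inv` holds at 0 too, so the case c = q^n, where both sides may vanish, needs no separate
    -- treatment.
    simp only [qFac, inv_inv]
    rw [← Finset.prod_range_reflect]
    congr 1
    refine Finset.prod_congr rfl fun j hj => ?_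
    have hj' : j ≤ n := by simpa [Nat.lt_succ_iff] using hj
    rw [mul_assoc, ← zpow_natCast q j, ← zpow_add₀ hq0]
    congr 3
    rw [Int.negSucc_eq]
    omega

/-- This makes each pair of parameters h q^m, h polynomial in q^k, up to a constant. -/
theorem qFac_div_qFac {y q : ℂ} (hq0 : q ≠ 0) (hq : ‖q‖ < 1)
    (h : ∀ i : ℤ, 1 - y * q ^ i ≠ 0) (m : ℕ) (k : ℤ) :
    qFac (y * q ^ m) q k / qFac y q k * qFac y q m = qFac (y * q ^ k) q m := by
  have hI : ∀ i : ℤ, qInf (y * q ^ i) q ≠ 0 := fun i => qInf_ne_zero hq fun j => by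
    rw [mul_assoc, ← zpow_natCast, ← zpow_add₀ hq0]
    exact h _
  have e1 : y * q ^ m * q ^ k = y * q ^ (m + k) := by
    rw [mul_assoc, ← zpow_natCast, ← zpow_add₀ hq0]
  have e2 : y * q ^ k * q ^ (m : ℤ) = y * q ^ (m + k) := by
    rw [mul_assoc, ← zpow_add₀ hq0, add_comm]
  have h0 := hI 0
  have hm := hI m
  have hk := hI k
  have hmk := hI (m + k)
  rw [zpow_zero, mul_one] at h0
  rw [qFac_eq_div (y * q ^ m) hq0 hq k (by rwa [e1]), qFac_eq_div y hq0 hq k hk,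
    qFac_eq_div y hq0 hq m hm, qFac_eq_div (y * q ^ k) hq0 hq m (by rwa [e2]), e1, e2,
    ← zpow_natCast q m]
  field_simp

theorem qFac_natCast_ne_zero {y q : ℂ} (h : ∀ j : ℕ, 1 - y * q ^ j ≠ 0) (m : ℕ) :
    qFac y q m ≠ 0 :=
  Finset.prod_ne_zero_iff.mpr fun j _ => h j

/-! ### Normalized terms of the bilateral series. -/

variable {s : ℕ}

/-- The normalizing factor `(q/a, q/b, c, d; q)_∞ ∏ (h_ν; q)_{m_ν}`. -/
noncomputable def normalizer (q a b c d : ℂ) (h : Fin s → ℂ) (m : Fin s → ℕ) : ℂ :=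
  qInf (q / a) q * qInf (q / b) q * qInf c q * qInf d q * ∏ ν, qFac (h ν) q (m ν)

theorem quadEuler_neg {q : ℂ} (hq : ‖q‖ < 1) (a b c d : ℂ) (k : ℤ) :
    quadEuler q (-a) (-b) (-c) (-d) k
      = qInf (c * q ^ k) q * (qInf (d * q ^ k) q *
        (qInf (a * q ^ (1 - k)) q * qInf (b * q ^ (1 - k)) q)) := by
  simp only [quadEuler, qInf_eq_euler hq, neg_mul]

section WellDefined

variable {q a b c d : ℂ} {h : Fin s → ℂ} {m : Fin s → ℕ}

theorem PsiWellDefined.append_iff :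
    PsiWellDefined (Fin.append ![a, b] fun ν => h ν * q ^ m ν) (Fin.append ![c, d] h) q ↔
      ((∀ j : ℕ, 1 - a * q ^ (-((j : ℤ) + 1)) ≠ 0) ∧ (∀ j : ℕ, 1 - b * q ^ (-((j : ℤ) + 1)) ≠ 0) ∧
        ∀ ν, ∀ j : ℕ, 1 - h ν * q ^ m ν * q ^ (-((j : ℤ) + 1)) ≠ 0) ∧
      (∀ j : ℕ, 1 - c * q ^ j ≠ 0) ∧ (∀ j : ℕ, 1 - d * q ^ j ≠ 0) ∧
        ∀ ν, ∀ j : ℕ, 1 - h ν * q ^ j ≠ 0 := by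
  simp only [PsiWellDefined, Fin.forall_fin_add, Fin.append_left, Fin.append_right,
    Fin.forall_fin_two, Matrix.cons_val_zero, Matrix.cons_val_one, and_assoc]

/-- The upper parameter y q^n excludes zeros at exponents i < n, the lower parameter y at i ≥ 0;
since n ≥ 0 these ranges cover ℤ. -/
theorem one_sub_mul_zpow_ne_zero {y : ℂ} {n : ℕ} (hq0 : q ≠ 0)
    (h₁ : ∀ j : ℕ, 1 - y * q ^ n * q ^ (-((j : ℤ) + 1)) ≠ 0) (h₂ : ∀ j : ℕ, 1 - y * q ^ j ≠ 0)
    (i : ℤ) : 1 - y * q ^ i ≠ 0 := by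
  rcases le_or_gt 0 i with hi | hi
  · obtain ⟨j, rfl⟩ := Int.eq_ofNat_of_zero_le hi
    simpa using h₂ j
  · have := h₁ (n - 1 - i).toNat
    rw [mul_assoc, ← zpow_natCast, ← zpow_add₀ hq0] at this
    convert this using 4
    omega

theorem normalizer_ne_zero (hq0 : q ≠ 0) (hq : ‖q‖ < 1) (ha : a ≠ 0) (hb : b ≠ 0)
    (hw : PsiWellDefined (Fin.append ![a, b] fun ν => h ν * q ^ m ν) (Fin.append ![c, d] h) q) :
    normalizer q a b c d h m ≠ 0 := by
  obtain ⟨⟨w₁, w₂, -⟩, w₄, w₅, w₆⟩ := PsiWellDefined.append_iff.mp hw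
  exact mul_ne_zero (mul_ne_zero (mul_ne_zero (mul_ne_zero (qInf_div_ne_zero hq0 hq ha w₁)
    (qInf_div_ne_zero hq0 hq hb w₂)) (qInf_ne_zero hq w₄)) (qInf_ne_zero hq w₅))
    (Finset.prod_ne_zero_iff.mpr fun ν _ => qFac_natCast_ne_zero (w₆ ν) _)

/-- Each of a and b contributes q^(k(k-1)/2) by `qFac_mul_qInf`; together they give the quadratic
exponent that the reflection needs. -/
theorem normalizer_mul_psiTerm (hq0 : q ≠ 0) (hq : ‖q‖ < 1) (ha : a ≠ 0) (hb : b ≠ 0)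
    (hw : PsiWellDefined (Fin.append ![a, b] fun ν => h ν * q ^ m ν) (Fin.append ![c, d] h) q)
    (z : ℂ) (k : ℤ) :
    normalizer q a b c d h m *
        psiTerm (Fin.append ![a, b] fun ν => h ν * q ^ m ν) (Fin.append ![c, d] h) q z k
      = (a * b * z) ^ k * q ^ (k * (k - 1)) * quadEuler q (-a⁻¹) (-b⁻¹) (-c) (-d) k *
        ∏ ν, qFac (h ν * q ^ k) q (m ν) := by
  obtain ⟨⟨w₁, w₂, w₃⟩, w₄, w₅, w₆⟩ := PsiWellDefined.append_iff.mp hw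
  have hh : (∏ ν, qFac (h ν * q ^ m ν) q k) / (∏ ν, qFac (h ν) q k) * ∏ ν, qFac (h ν) q (m ν)
      = ∏ ν, qFac (h ν * q ^ k) q (m ν) := by
    rw [← Finset.prod_div_distrib, ← Finset.prod_mul_distrib]
    exact Finset.prod_congr rfl fun ν _ =>
      qFac_div_qFac hq0 hq (one_sub_mul_zpow_ne_zero hq0 (w₃ ν) (w₆ ν)) _ _
  have hexp : q ^ (k * (k - 1)) = q ^ (k * (k - 1) / 2) * q ^ (k * (k - 1) / 2) := by
    rw [← zpow_add₀ hq0, ← two_mul, Int.mul_ediv_cancel' (Int.even_mul_pred_self k).two_dvd]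
  have hab : (a * b * z) ^ k = (-a) ^ k * (-b) ^ k * z ^ k := by
    rw [← mul_zpow, ← mul_zpow]
    congr 1
    ring
  rw [quadEuler_neg hq, ← hh, hexp, hab, ← inv_qFac_mul_qInf hq0 hq w₄ k,
    ← inv_qFac_mul_qInf hq0 hq w₅ k]
  simp only [psiTerm, normalizer, Fin.prod_univ_add, Fin.append_left, Fin.append_right,
    Fin.prod_univ_two, Matrix.cons_val_zero, Matrix.cons_val_one, sub_self, zpow_zero, mul_one,
    div_eq_mul_inv, mul_inv]
  have t₁ := qFac_mul_qInf hq0 hq ha w₁ k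
  have t₂ := qFac_mul_qInf hq0 hq hb w₂ k
  rw [div_eq_mul_inv] at t₁ t₂
  linear_combination ((∏ ν, qFac (h ν * q ^ m ν) q k) * (∏ ν, qFac (h ν) q k)⁻¹ *
    (∏ ν, qFac (h ν) q (m ν)) * ((qFac c q k)⁻¹ * qInf c q) * ((qFac d q k)⁻¹ * qInf d q) * z ^ k)
    * (qFac b q k * qInf (q * b⁻¹) q * t₁
      + (-a) ^ k * q ^ (k * (k - 1) / 2) * qInf (a⁻¹ * q ^ (1 - k)) q * t₂)

end WellDefined

/-! ### Inserting the polynomial factor. -/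

open Polynomial in
theorem exists_polynomial_eval_eq_prod_qFac {s : ℕ} (q : ℂ) (h : Fin s → ℂ) (m : Fin s → ℕ) :
    ∃ P : ℂ[X], P.natDegree ≤ ∑ ν, m ν ∧ ∀ x, P.eval x = ∏ ν, qFac (h ν * x) q (m ν) := by
  refine ⟨∏ ν, ∏ j ∈ Finset.range (m ν), (1 - C (h ν * q ^ j) * X), ?_, fun x => ?_⟩
  · refine (natDegree_prod_le _ _).trans (Finset.sum_le_sum fun ν _ => ?_)
    refine (natDegree_prod_le _ _).trans ?_
    refine (Finset.sum_le_card_nsmul (Finset.range (m ν)) _ 1 fun j _ => ?_).trans_eq (by simp)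
    exact natDegree_sub_le_of_le (natDegree_one.trans_le zero_le_one)
      ((natDegree_C_mul_le _ _).trans natDegree_X_le)
  · simp only [eval_prod, eval_sub, eval_one, eval_mul, eval_C, eval_X]
    refine Finset.prod_congr rfl fun ν _ => Finset.prod_congr rfl fun j _ => ?_
    ring

/-- The bilateral sums of `e^k q^(k(k-1)) g(q^k)` and `e^(1-k) q^(k(k-1)) g(q^k/e)` agree for
`g(x) = x^(-N) (-c x, -d x, -a q/x, -b q/x; q)_∞ P(x)` with a polynomial `P`. -/
theorem exists_hasSum_quadEuler_eval {q e a b c d : ℂ} (hq0 : 0 < ‖q‖) (hq : ‖q‖ < 1)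
    (he : e ≠ 0) (N : ℤ) (P : Polynomial ℂ) {m : ℕ} (hP : P.natDegree ≤ m)
    (h : ‖e * (a * b)‖ < ‖q ^ N‖) (h' : ‖c * d * q ^ N‖ < ‖e * q ^ m‖) :
    ∃ S : ℂ,
      HasSum (fun k : ℤ => (e * q ^ (-N)) ^ k * q ^ (k * (k - 1)) * quadEuler q a b c d k *
        P.eval (q ^ k)) S ∧
      HasSum (fun k : ℤ => e ^ (1 + N) * ((e⁻¹ * q ^ (-N)) ^ k * q ^ (k * (k - 1)) *
        quadEuler q (a * e) (b * e) (c / e) (d / e) k * P.eval (q ^ k / e))) S := by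
  have hq0' : q ≠ 0 := norm_pos_iff.mp hq0
  have hN : 0 < ‖q ^ N‖ := norm_pos_iff.mpr (zpow_ne_zero N hq0')
  have hzN : ∀ n : ℕ, q ^ ((n : ℤ) - N) = q ^ n / q ^ N := fun n => by
    rw [zpow_sub₀ hq0', zpow_natCast]
  -- Each monomial x^n of P is the case M = n - N. As |q| < 1, the first inequality is tightest at n
  -- = 0 and the second at n = m, so the degree bound enters only the second.
  have key : ∀ n ∈ Finset.range (m + 1), ∃ S : ℂ,
      HasSum (fun k : ℤ => (e * q ^ (-N)) ^ k * q ^ (k * (k - 1)) * quadEuler q a b c d k *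
        (P.coeff n * (q ^ k) ^ n)) S ∧
      HasSum (fun k : ℤ => e ^ (1 + N) * ((e⁻¹ * q ^ (-N)) ^ k * q ^ (k * (k - 1)) *
        quadEuler q (a * e) (b * e) (c / e) (d / e) k * (P.coeff n * (q ^ k / e) ^ n))) S := by
    intro n hn
    have hnm : n ≤ m := Nat.lt_succ_iff.mp (Finset.mem_range.mp hn)
    have hn₁ : ‖e * q ^ ((n : ℤ) - N) * (a * b)‖ < 1 := by
      rw [hzN, show e * (q ^ n / q ^ N) * (a * b) = e * (a * b) * q ^ n / q ^ N by ring, norm_div,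
        div_lt_one hN, norm_mul, norm_pow]
      exact (mul_le_of_le_one_right (norm_nonneg _) (pow_le_one₀ hq0.le hq.le)).trans_lt h
    have hn₂ : ‖c * d‖ < ‖e * q ^ ((n : ℤ) - N)‖ := by
      rw [hzN, ← mul_div_assoc, norm_div, lt_div_iff₀ hN, ← norm_mul]
      refine h'.trans_le ?_
      rw [norm_mul, norm_mul, norm_pow, norm_pow]
      exact mul_le_mul_of_nonneg_left (pow_le_pow_of_le_one hq0.le hq.le hnm) (norm_nonneg e)
    obtain ⟨S, h₁, h₂⟩ := exists_hasSum_quadEuler (a := a) (b := b) (c := c) (d := d) hq0 hq he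
      ((n : ℤ) - N) hn₁ hn₂
    · refine ⟨P.coeff n * S, (h₁.mul_left (P.coeff n)).congr_fun fun k => ?_,
        (h₂.mul_left (P.coeff n)).congr_fun fun k => ?_⟩
      · have : (q ^ ((n : ℤ) - N)) ^ k = (q ^ (-N)) ^ k * (q ^ k) ^ n := by
          rw [← zpow_mul, ← zpow_mul, ← zpow_natCast, ← zpow_mul, ← zpow_add₀ hq0']
          congr 1
          ring
        rw [mul_zpow e, mul_zpow e, this]
        ring
      · have : (q ^ ((n : ℤ) - N)) ^ k = (q ^ (-N)) ^ k * (q ^ k) ^ n := by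
          rw [← zpow_mul, ← zpow_mul, ← zpow_natCast, ← zpow_mul, ← zpow_add₀ hq0']
          congr 1
          ring
        have h3 : e ^ (1 - ((n : ℤ) - N)) = e ^ (1 + N) / e ^ n := by
          rw [← zpow_natCast, ← zpow_sub₀ he]
          congr 1
          ring
        rw [mul_zpow e⁻¹, mul_zpow e⁻¹, this, h3, div_pow]
        ring
  choose! S hS₁ hS₂ using key
  refine ⟨∑ n ∈ Finset.range (m + 1), S n, (hasSum_sum hS₁).congr_fun fun k => ?_,
    (hasSum_sum hS₂).congr_fun fun k => ?_⟩
  · rw [P.eval_eq_sum_range' (Nat.lt_succ_of_le hP), Finset.mul_sum]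
  · rw [P.eval_eq_sum_range' (Nat.lt_succ_of_le hP), Finset.mul_sum, Finset.mul_sum]

theorem quadEuler_add_one {q : ℂ} (hq0 : q ≠ 0) (a b c d : ℂ) (k : ℤ) :
    quadEuler q a b c d (k + 1) = quadEuler q (a / q) (b / q) (c * q) (d * q) k := by
  have h1 : q ^ (k + 1) = q * q ^ k := zpow_one_add₀ hq0 k ▸ by rw [add_comm]
  have h2 : q ^ (1 - (k + 1)) = q⁻¹ * q ^ (1 - k) := by
    rw [← zpow_neg_one, ← zpow_add₀ hq0]
    congr 1
    ring
  simp only [quadEuler, h1, h2, div_eq_mul_inv, mul_assoc]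

end BasicHyp

/-! ### The transformation formula. -/

theorem mainTheorem4
    (q : ℂ) (hq0 : 0 < ‖q‖) (hq1 : ‖q‖ < 1)
    (s : ℕ) (a b c d e : ℂ) (h : Fin s → ℂ) (m : Fin s → ℕ) (N : ℤ)
    (ha : a ≠ 0) (hb : b ≠ 0) (he : e ≠ 0)
    -- both series are well-defined
    (hL : BasicHyp.PsiWellDefined
      (Fin.append ![a, b] (fun ν => h ν * q ^ m ν)) (Fin.append ![c, d] h) q)
    (hR : BasicHyp.PsiWellDefined
      (Fin.append ![a * q / e, b * q / e] (fun ν => h ν * q ^ (1 + m ν) / e))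
      (Fin.append ![c * q / e, d * q / e] (fun ν => h ν * q / e)) q)
    -- `|e/ab| < |q^N| < |e q^|m| / cd|`, cleared of the denominator `cd`, which may vanish
    (hconv1 : ‖e / (a * b)‖ < ‖q ^ N‖)
    (hconv2 : ‖c * d * q ^ N‖ < ‖e * q ^ (∑ ν, m ν)‖) :
    Summable (BasicHyp.psiTerm
      (Fin.append ![a, b] (fun ν => h ν * q ^ m ν)) (Fin.append ![c, d] h)
      q (e * q ^ (-N) / (a * b))) ∧
    Summable (BasicHyp.psiTerm
      (Fin.append ![a * q / e, b * q / e] (fun ν => h ν * q ^ (1 + m ν) / e))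
      (Fin.append ![c * q / e, d * q / e] (fun ν => h ν * q / e))
      q (e * q ^ (-N) / (a * b))) ∧
    BasicHyp.psi
      (Fin.append ![a, b] (fun ν => h ν * q ^ m ν)) (Fin.append ![c, d] h)
      q (e * q ^ (-N) / (a * b))
    = (e / q) ^ N
      * ((BasicHyp.qInf (e / a) q * BasicHyp.qInf (e / b) q
          * BasicHyp.qInf (c * q / e) q * BasicHyp.qInf (d * q / e) q)
        / (BasicHyp.qInf (q / a) q * BasicHyp.qInf (q / b) q
          * BasicHyp.qInf c q * BasicHyp.qInf d q))
      * (∏ ν, BasicHyp.qFac (h ν * q / e) q (m ν) / BasicHyp.qFac (h ν) q (m ν))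
      * BasicHyp.psi
        (Fin.append ![a * q / e, b * q / e] (fun ν => h ν * q ^ (1 + m ν) / e))
        (Fin.append ![c * q / e, d * q / e] (fun ν => h ν * q / e))
        q (e * q ^ (-N) / (a * b)) := by
  have hq : q ≠ 0 := norm_pos_iff.mp hq0
  have ha' : a * q / e ≠ 0 := div_ne_zero (mul_ne_zero ha hq) he
  have hb' : b * q / e ≠ 0 := div_ne_zero (mul_ne_zero hb hq) he
  have hup : (fun ν => h ν * q ^ (1 + m ν) / e) = fun ν => h ν * q / e * q ^ m ν := by
    funext ν
    ring
  rw [hup] at hR ⊢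
  obtain ⟨P, hPdeg, hP⟩ := BasicHyp.exists_polynomial_eval_eq_prod_qFac q h m
  -- The signs are those of `euler q y` = (-y;q)_∞; the inverses come from the reflected factors
  -- (q^(1-k)/a, q^(1-k)/b; q)_∞.
  obtain ⟨S, h₁, h₂⟩ := BasicHyp.exists_hasSum_quadEuler_eval (a := -a⁻¹) (b := -b⁻¹) (c := -c)
    (d := -d) hq0 hq1 he N P hPdeg
    (by rwa [neg_mul_neg, ← mul_inv, ← div_eq_mul_inv]) (by rwa [neg_mul_neg])
  have hD := BasicHyp.normalizer_ne_zero hq hq1 ha hb hL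
  have hD' := BasicHyp.normalizer_ne_zero hq hq1 ha' hb' hR
  have hLs : HasSum (fun k : ℤ => BasicHyp.normalizer q a b c d h m *
      BasicHyp.psiTerm (Fin.append ![a, b] (fun ν => h ν * q ^ m ν)) (Fin.append ![c, d] h)
        q (e * q ^ (-N) / (a * b)) k) S := by
    refine h₁.congr_fun fun k => ?_
    rw [BasicHyp.normalizer_mul_psiTerm hq hq1 ha hb hL, hP,
      mul_div_cancel₀ _ (mul_ne_zero ha hb)]
  have hRs : HasSum (fun k : ℤ => (e / q) ^ N *
      (BasicHyp.normalizer q (a * q / e) (b * q / e) (c * q / e) (d * q / e)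
        (fun ν => h ν * q / e) m * BasicHyp.psiTerm
        (Fin.append ![a * q / e, b * q / e] (fun ν => h ν * q / e * q ^ m ν))
        (Fin.append ![c * q / e, d * q / e] (fun ν => h ν * q / e))
        q (e * q ^ (-N) / (a * b)) k)) S := by
    -- The lower parameters are cq/e and dq/e rather than c/e and d/e, so the k-th term on the right
    -- matches index k + 1 of the reflected sum. The shift also supplies the factor e⁻¹ q^(-N) that
    -- turns e^(1+N) into (e/q)^N.
    refine ((Equiv.addRight (1 : ℤ)).hasSum_iff.mpr h₂).congr_fun fun k => ?_
    rw [BasicHyp.normalizer_mul_psiTerm hq hq1 ha' hb' hR]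
    simp only [Function.comp, Equiv.coe_addRight, BasicHyp.quadEuler_add_one hq, hP]
    have z1 : a * q / e * (b * q / e) * (e * q ^ (-N) / (a * b)) = e⁻¹ * q ^ (-N) * (q * q) := by
      field_simp
    have z2 : (q * q) ^ k * q ^ (k * (k - 1)) = q ^ ((k + 1) * (k + 1 - 1)) := by
      rw [mul_zpow, ← zpow_add₀ hq, ← zpow_add₀ hq]
      congr 1
      ring
    have z3 : (e / q) ^ N = e ^ (1 + N) * (e⁻¹ * q ^ (-N)) := by
      rw [div_zpow, zpow_add₀ he, zpow_one, zpow_neg]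
      field_simp
    have z4 : ∀ ν, h ν * q / e * q ^ k = h ν * (q ^ (k + 1) / e) := fun ν => by
      rw [zpow_add_one₀ hq]
      ring
    have z5 : ∀ x : ℂ, -(x * q / e)⁻¹ = -x⁻¹ * e / q := fun x => by
      rw [inv_div, div_eq_mul_inv, mul_inv]
      ring
    have z6 : ∀ x : ℂ, -(x * q / e) = -x / e * q := fun x => by ring
    have z7 : (e⁻¹ * q ^ (-N)) ^ (k + 1) = (e⁻¹ * q ^ (-N)) ^ k * (e⁻¹ * q ^ (-N)) :=
      zpow_add_one₀ (mul_ne_zero (inv_ne_zero he) (zpow_ne_zero _ hq)) k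
    simp only [z4, z5, z6]
    rw [z1, z3, z7, ← z2, mul_zpow _ (q * q)]
    ring
  have hLs' := hLs.summable.mul_left (BasicHyp.normalizer q a b c d h m)⁻¹
  simp only [inv_mul_cancel_left₀ hD] at hLs'
  have hRs' := (hRs.summable.mul_left ((e / q) ^ N)⁻¹).mul_left
    (BasicHyp.normalizer q (a * q / e) (b * q / e) (c * q / e) (d * q / e)
      (fun ν => h ν * q / e) m)⁻¹
  simp only [inv_mul_cancel_left₀ hD', inv_mul_cancel_left₀ (zpow_ne_zero N (div_ne_zero he hq))]
    at hRs'
  refine ⟨hLs', hRs', ?_⟩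
  have hEq := hLs.tsum_eq.trans hRs.tsum_eq.symm
  rw [tsum_mul_left, tsum_mul_left, tsum_mul_left] at hEq
  -- This identifies the first two factors of the right normalizer as (e/a, e/b; q)_∞.
  have hqe : ∀ x : ℂ, q / (x * q / e) = e / x := fun x => by
    rw [div_div_eq_mul_div, mul_comm x q, mul_div_mul_left _ _ hq]
  refine mul_left_cancel₀ hD (hEq.trans ?_)
  simp only [BasicHyp.normalizer, hqe, Finset.prod_div_distrib, BasicHyp.psi, mul_ne_zero_iff]
    at hD ⊢
  obtain ⟨⟨⟨⟨d₁, d₂⟩, d₃⟩, d₄⟩, d₅⟩ := hD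
  field_simp
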